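/- Corollary ("No small local marginals"). Consider $n$ qubits, with Hilbert space $(\mathbb{C}^2)^{\otimes n}$. A Pauli product is an operator $P = P_1 \otimes \cdots \otimes P_n$ with each $P_i \in \{I, \sigma_x, \sigma_y, \sigma_z\}$; its support is $\operatorname{supp}(P) = \{ i : P_i \neq I \}$. The dual interaction graph of a family of distinct Pauli products has the members of the family as its vertices, and two different members are adjacent if and only if their supports intersect. For all non-negative integers $k, d, k', d'$ there are real constants $c, c'$, depending only on $k, d, k', d'$, such that the following holds for every $n$. Let $H = \sum_{a=1}^m \lambda_a E_a$, where the $E_a$ are distinct non-identity Pauli products on $n$ qubits with $|\operatorname{supp}(E_a)| \le k$ whose dual interaction graph has maximum degree at most $d$, and $\lambda_a \in [-1,1]$. Let $\beta > 0$ and let $\rho = e^{-\beta H} / \operatorname{Tr} e^{-\beta H}$ be the Gibbs state. Let $A = \sum_{P} \sigma_P P$ be a linear combination, with arbitrary coefficients $\sigma_P \in \mathbb{R}$, of distinct Pauli products with $|\operatorname{supp}(P)| \le k'$ whose dual interaction graph has maximum degree at most $d'$. Then $\operatorname{tr}(A^2 \rho)$ is real and $$\operatorname{tr}(A^2 \rho)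 \;\ge\; \exp(-c - c'\beta)\, \sigma_Q^2 \qquad \text{for every term } Q \ne I^{\otimes n} \text{ of } A,$$ that is, $\operatorname{tr}(A^2\rho) \ge \exp(-c - c'\beta) \max_{Q \neq I^{\otimes n}} \sigma_Q^2$. -/

import Mathlib

open scoped ComplexOrder

/-- Labels of the four single-qubit Pauli matrices; `I` is the identity. -/
inductive Pauli where
  | I
  | X
  | Y
  | Z
  deriving DecidableEq

/-- The `2 × 2` Pauli matrix with a given label. -/
noncomputable def Pauli.toMatrix : Pauli → Matrix (Fin 2) (Fin 2) ℂ
  | Pauli.I => !![1, 0; 0, 1]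
  | Pauli.X => !![0, 1; 1, 0]
  | Pauli.Y => !![0, -Complex.I; Complex.I, 0]
  | Pauli.Z => !![1, 0; 0, -1]

/-- A product of Pauli matrices on `n` qubits, given by its tensor factors. -/
abbrev PauliString (n : ℕ) : Type := Fin n → Pauli

namespace PauliString

/-- The identity Pauli product. -/
def identity (n : ℕ) : PauliString n := fun _ => Pauli.I

/-- The qubits on which a Pauli product acts non-trivially. -/
def support {n : ℕ} (P : PauliString n) : Finset (Fin n) :=
  Finset.univ.filter fun i => P i ≠ Pauli.I

/-- The tensor product `P₁ ⊗ ⋯ ⊗ Pₙ` as an operator on `(ℂ²)^{⊗ n}`, whose standard basis is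
indexed by bit strings `Fin n → Fin 2`. -/
noncomputable def toMatrix {n : ℕ} (P : PauliString n) :
    Matrix (Fin n → Fin 2) (Fin n → Fin 2) ℂ :=
  Matrix.of fun x y => ∏ i, (P i).toMatrix (x i) (y i)

end PauliString

/-- A real linear combination `∑ a, coeff a • term a` of `m` pairwise distinct Pauli products on
`n` qubits. -/
structure PauliSum (n m : ℕ) where
  term : Fin m → PauliString n
  coeff : Fin m → ℝ
  term_injective : Function.Injective term

namespace PauliSum

variable {n m : ℕ}

/-- The operator `∑ a, coeff a • term a`. -/
noncomputable def op (A : PauliSum n m) : Matrix (Fin n → Fin 2) (Fin n → Fin 2) ℂ :=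
  ∑ a, (A.coeff a : ℂ) • (A.term a).toMatrix

/-- Every term is supported on at most `k` qubits. -/
def IsLocal (A : PauliSum n m) (k : ℕ) : Prop :=
  ∀ a, (A.term a).support.card ≤ k

/-- The dual interaction graph: the vertices are (the indices of) the terms, and two different
terms are adjacent when their supports intersect. -/
def dualGraph (A : PauliSum n m) : SimpleGraph (Fin m) where
  Adj a b := a ≠ b ∧ ((A.term a).support ∩ (A.term b).support).Nonempty
  symm := ⟨fun _ _ h => ⟨h.1.symm, by rw [Finset.inter_comm]; exact h.2⟩⟩
  loopless := ⟨fun _ h => h.1 rfl⟩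

instance (A : PauliSum n m) : DecidableRel A.dualGraph.Adj := fun a b =>
  inferInstanceAs (Decidable (a ≠ b ∧ ((A.term a).support ∩ (A.term b).support).Nonempty))

/-- The normalization of a Hamiltonian: the terms are traceless, that is, different from the
identity, and the coefficients have absolute value at most `1`. -/
structure IsHamiltonian (H : PauliSum n m) : Prop where
  term_ne_identity : ∀ a, H.term a ≠ PauliString.identity n
  abs_coeff_le_one : ∀ a, |H.coeff a| ≤ 1

/-- The Gibbs state `exp (-βH) / Tr exp (-βH)` at inverse temperature `β`. -/
noncomputable def gibbs (H : PauliSum n m) (β : ℝ) :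
    Matrix (Fin n → Fin 2) (Fin n → Fin 2) ℂ :=
  (NormedSpace.exp (-(β : ℂ) • H.op)).trace⁻¹ • NormedSpace.exp (-(β : ℂ) • H.op)

end PauliSum

/-! Scale `A` so that its largest coefficient on a nontrivial term, attained at `b`, has modulus 1,
and measure operators by ‖X‖ = √tr(X ρ X*). Conjugation by a Pauli product `U` only changes signs of
terms. Averaging the displacements `D = UAU - A` against the sign of `U` and term `b`, over all `U`
on the neighborhood of `b`, isolates that term, so some `U` has ‖D‖ ≥ 1
(`exists_abs_coeff_le_stateNorm`). This `D` involves boundedly many terms.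

If ‖A‖ > 1/4 there is nothing to prove. Otherwise `B = UAU` is far from 0 in the state ρ, while ‖BD‖
≤ G for a constant `G`, because `BD = DA + [A, D] + D²` and each Pauli product in `D` fails to
commute with few terms of `A`. A Paley–Zygmund argument (`le_trace_indicator_conj`) then shows that
in the state UρU a measurement of `A` gives |x| ≥ 1/4 with probability at least p = 1/(4G²).

It remains to return from UρU to ρ. Both are Gibbs states with the same partition function, and
their Hamiltonians differ by boundedly many terms. Tilting by a multiple of the event, with
Peierls–Bogoliubov from below and Golden–Thompson from above, bounds the probability in ρ below by
exp(-(O(β) + log 2)/p) (`exp_mul_trace_exp_le_of_event`). Chebyshev's inequality at 1/4 finishes the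
proof. -/

/-! ### Exponentials in Banach algebras and the Lie–Trotter formula. -/

/-- The norm of the exponential in a Banach algebra is at most the exponential of the norm. -/
theorem NormedSpace.norm_exp_le {𝔸 : Type*} [NormedRing 𝔸] [NormedAlgebra ℝ 𝔸] [NormOneClass 𝔸]
    [CompleteSpace 𝔸] (x : 𝔸) : ‖NormedSpace.exp x‖ ≤ Real.exp ‖x‖ := by
  have h1 := NormedSpace.norm_expSeries_summable' (𝕂 := ℝ) x
  have h2 := NormedSpace.norm_expSeries_summable' (𝕂 := ℝ) ‖x‖
  rw [Real.exp_eq_exp_ℝ, NormedSpace.exp_eq_tsum ℝ, NormedSpace.exp_eq_tsum ℝ]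
  refine (norm_tsum_le_tsum_norm h1).trans (h1.tsum_le_tsum (fun n => ?_) h2.of_norm)
  rw [norm_smul, smul_eq_mul, norm_inv, Real.norm_natCast]
  gcongr
  exact norm_pow_le x n

/-- Telescoping bound for the difference of two powers. -/
theorem norm_pow_sub_pow_le_of_norm_le {𝔸 : Type*} [NormedRing 𝔸] [NormOneClass 𝔸]
    {a b : 𝔸} {C : ℝ} (ha : ‖a‖ ≤ C) (hb : ‖b‖ ≤ C) (n : ℕ) :
    ‖a ^ (n + 1) - b ^ (n + 1)‖ ≤ (n + 1) * C ^ n * ‖a - b‖ := by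
  induction n with
  | zero => simp
  | succ n ih =>
    have hC : 0 ≤ C := (norm_nonneg _).trans ha
    have e : a ^ (n + 1 + 1) - b ^ (n + 1 + 1)
        = a ^ (n + 1) * (a - b) + (a ^ (n + 1) - b ^ (n + 1)) * b := by
      rw [pow_succ a (n + 1), pow_succ b (n + 1)]; noncomm_ring
    calc _ ≤ ‖a ^ (n + 1)‖ * ‖a - b‖ + ‖a ^ (n + 1) - b ^ (n + 1)‖ * ‖b‖ := by
          rw [e]
          exact (norm_add_le _ _).trans (add_le_add (norm_mul_le _ _) (norm_mul_le _ _))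
      _ ≤ C ^ (n + 1) * ‖a - b‖ + ((n + 1) * C ^ n * ‖a - b‖) * C := by
          gcongr
          exact (norm_pow_le _ _).trans (pow_le_pow_left₀ (norm_nonneg _) ha _)
      _ = _ := by push_cast; ring

open Filter Topology in
/-- The Lie–Trotter product formula. -/
theorem tendsto_exp_mul_exp_pow {𝔸 : Type*} [NormedRing 𝔸] [NormedAlgebra ℝ 𝔸]
    [NormOneClass 𝔸] [CompleteSpace 𝔸] (x y : 𝔸) :
    Tendsto (fun n : ℕ => (NormedSpace.exp (((n : ℝ) + 1)⁻¹ • x) *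
      NormedSpace.exp (((n : ℝ) + 1)⁻¹ • y)) ^ (n + 1)) atTop (𝓝 (NormedSpace.exp (x + y))) := by
  set f : ℝ → 𝔸 := fun t => NormedSpace.exp (t • x) * NormedSpace.exp (t • y) with hf
  set g : ℝ → 𝔸 := fun t => NormedSpace.exp (t • (x + y)) with hg
  -- Both curves have velocity `x + y` at 0, so they differ by o(t). This beats the factor `n + 1`
  -- that telescoping costs.
  have hder : HasDerivAt (fun t => f t - g t) 0 0 := by
    have h1 := (hasDerivAt_exp_smul_const (𝕂 := ℝ) x (0 : ℝ)).mul
      (hasDerivAt_exp_smul_const (𝕂 := ℝ) y (0 : ℝ))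
    have h2 := h1.sub (hasDerivAt_exp_smul_const (𝕂 := ℝ) (x + y) (0 : ℝ))
    exact h2.congr_deriv (by simp)
  have h0 : f 0 - g 0 = 0 := by simp [hf, hg]
  set t : ℕ → ℝ := fun n => ((n : ℝ) + 1)⁻¹ with ht
  have htpos : ∀ n, 0 < t n := fun n => by positivity
  have htlim : Tendsto t atTop (𝓝[≠] 0) := by
    refine tendsto_nhdsWithin_iff.2 ⟨?_, Eventually.of_forall fun n => (htpos n).ne'⟩
    simpa [ht, one_div] using tendsto_one_div_add_atTop_nhds_zero_nat (𝕜 := ℝ)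
  have hslope : Tendsto (fun n => (t n)⁻¹ • (f (t n) - g (t n))) atTop (𝓝 0) := by
    have := (hasDerivAt_iff_tendsto_slope.1 hder).comp htlim
    refine this.congr fun n => ?_
    simp [slope, h0]
  have hpow : ∀ n, g (t n) ^ (n + 1) = NormedSpace.exp (x + y) := fun n => by
    have hne : ((n : ℝ) + 1) ≠ 0 := by positivity
    let : NormedAlgebra ℚ 𝔸 := NormedAlgebra.restrictScalars ℚ ℝ 𝔸
    simp only [hg]
    rw [← NormedSpace.exp_nsmul, ← Nat.cast_smul_eq_nsmul ℝ, smul_smul]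
    push_cast
    rw [mul_inv_cancel₀ hne, one_smul]
  rw [tendsto_iff_norm_sub_tendsto_zero]
  have hbound : ∀ n, ‖f (t n) ^ (n + 1) - NormedSpace.exp (x + y)‖
      ≤ Real.exp (‖x‖ + ‖y‖) * ‖(t n)⁻¹ • (f (t n) - g (t n))‖ := fun n => by
    have ht1 : t n * n ≤ 1 := by
      simp only [ht]; rw [inv_mul_le_iff₀ (by positivity)]; linarith
    have hfn : ‖f (t n)‖ ≤ Real.exp (t n * (‖x‖ + ‖y‖)) := by
      rw [mul_add, Real.exp_add]
      refine (norm_mul_le _ _).trans (mul_le_mul ?_ ?_ (norm_nonneg _) (Real.exp_nonneg _))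
      all_goals
        refine (NormedSpace.norm_exp_le _).trans_eq ?_
        rw [norm_smul, Real.norm_of_nonneg (htpos n).le]
    have hgn : ‖g (t n)‖ ≤ Real.exp (t n * (‖x‖ + ‖y‖)) := by
      refine (NormedSpace.norm_exp_le _).trans (Real.exp_le_exp.2 ?_)
      rw [norm_smul, Real.norm_of_nonneg (htpos n).le]
      exact mul_le_mul_of_nonneg_left (norm_add_le _ _) (htpos n).le
    rw [← hpow n]
    refine (norm_pow_sub_pow_le_of_norm_le hfn hgn n).trans ?_
    rw [norm_smul, norm_inv, Real.norm_of_nonneg (htpos n).le, ← Real.exp_nat_mul]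
    have e : (t n)⁻¹ = n + 1 := by simp [ht]
    rw [e, mul_comm ((n : ℝ) + 1), mul_assoc]
    gcongr
    calc (n : ℝ) * (t n * (‖x‖ + ‖y‖)) = t n * n * (‖x‖ + ‖y‖) := by ring
      _ ≤ 1 * (‖x‖ + ‖y‖) := by gcongr
      _ = _ := one_mul _
  refine squeeze_zero (fun _ => norm_nonneg _) hbound ?_
  simpa using (hslope.norm.const_mul (Real.exp (‖x‖ + ‖y‖)))

/-! ### The seminorm of a state and the Golden–Thompson inequality. -/

namespace Matrix

variable {ι : Type*} [Fintype ι]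

/-- The seminorm `X ↦ √tr(X M X*)` attached to a positive semidefinite matrix `M`. -/
noncomputable def stateNorm (M X : Matrix ι ι ℂ) : ℝ := √(X * M * Xᴴ).trace.re

theorem stateNorm_nonneg (M X : Matrix ι ι ℂ) : 0 ≤ stateNorm M X := Real.sqrt_nonneg _

theorem PosSemidef.re_trace_conj_nonneg {M : Matrix ι ι ℂ} (hM : M.PosSemidef)
    (X : Matrix ι ι ℂ) : 0 ≤ (X * M * Xᴴ).trace.re :=
  (Complex.nonneg_iff.1 (hM.mul_mul_conjTranspose_same X).trace_nonneg).1

theorem sq_stateNorm {M : Matrix ι ι ℂ} (hM : M.PosSemidef) (X : Matrix ι ι ℂ) :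
    stateNorm M X ^ 2 = (X * M * Xᴴ).trace.re :=
  Real.sq_sqrt (hM.re_trace_conj_nonneg X)

/-- Cauchy–Schwarz for the inner product `tr(Y M X*)`. -/
theorem norm_trace_mul_mul_conjTranspose_le {M : Matrix ι ι ℂ} (hM : M.PosSemidef)
    (X Y : Matrix ι ι ℂ) : ‖(Y * M * Xᴴ).trace‖ ≤ stateNorm M X * stateNorm M Y := by
  let := M.toMatrixSeminormedAddCommGroup hM
  let := M.toMatrixInnerProductSpace hM
  -- The inner product attached to `M` is definitionally tr(Y M X*), and `stateNorm M` is its norm.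
  exact norm_inner_le_norm (𝕜 := ℂ) X Y

theorem stateNorm_add_le {M : Matrix ι ι ℂ} (hM : M.PosSemidef) (X Y : Matrix ι ι ℂ) :
    stateNorm M (X + Y) ≤ stateNorm M X + stateNorm M Y := by
  let := M.toMatrixSeminormedAddCommGroup hM
  exact norm_add_le X Y

theorem stateNorm_smul {M : Matrix ι ι ℂ} (hM : M.PosSemidef) (c : ℂ) (X : Matrix ι ι ℂ) :
    stateNorm M (c • X) = ‖c‖ * stateNorm M X := by
  let := M.toMatrixSeminormedAddCommGroup hM
  let := M.toMatrixInnerProductSpace hM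
  exact norm_smul c X

theorem stateNorm_sum_le {M : Matrix ι ι ℂ} (hM : M.PosSemidef) {κ : Type*} (s : Finset κ)
    (X : κ → Matrix ι ι ℂ) : stateNorm M (∑ a ∈ s, X a) ≤ ∑ a ∈ s, stateNorm M (X a) := by
  let := M.toMatrixSeminormedAddCommGroup hM
  exact norm_sum_le s X

variable [DecidableEq ι]

/-- Cyclicity of the trace. Only left multiplication is isometric; this asymmetry is why commutators
have to be estimated later. -/
theorem stateNorm_unitary_mul {M U : Matrix ι ι ℂ} (hU : Uᴴ * U = 1) (X : Matrix ι ι ℂ) :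
    stateNorm M (U * X) = stateNorm M X := by
  have : (U * X * M * (U * X)ᴴ).trace = (X * M * Xᴴ).trace := by
    rw [conjTranspose_mul, ← mul_assoc, trace_mul_comm, ← mul_assoc, ← mul_assoc, ← mul_assoc, hU,
      one_mul]
  rw [stateNorm, this, stateNorm]

theorem trace_mul_pow_comm (A B : Matrix ι ι ℂ) (n : ℕ) :
    ((A * B) ^ n).trace = ((B * A) ^ n).trace := by
  cases n with
  | zero => simp
  | succ n => rw [pow_succ, ← mul_assoc, mul_pow_mul, mul_assoc, trace_mul_comm, mul_assoc,
      ← pow_succ]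

theorem norm_trace_sq_le (A : Matrix ι ι ℂ) : ‖(A * A).trace‖ ≤ (Aᴴ * A).trace.re := by
  have h := norm_trace_mul_mul_conjTranspose_le (PosSemidef.one (n := ι) (R := ℂ)) Aᴴ A
  simp only [stateNorm, mul_one, conjTranspose_conjTranspose] at h
  rw [trace_mul_comm A Aᴴ, Real.mul_self_sqrt] at h
  · exact h
  · simpa using (PosSemidef.one (n := ι) (R := ℂ)).re_trace_conj_nonneg Aᴴ

/-- The trace inequalities behind the Golden–Thompson inequality, for exponents that are powers
of two. -/
theorem trace_two_pow_aux (j : ℕ) :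
    (∀ A : Matrix ι ι ℂ, ‖(A ^ 2 ^ (j + 1)).trace‖ ≤ ((Aᴴ * A) ^ 2 ^ j).trace.re) ∧
    ∀ A B : Matrix ι ι ℂ, A.IsHermitian → B.IsHermitian →
      ((A * B) ^ 2 ^ j).trace.re ≤ (A ^ 2 ^ j * B ^ 2 ^ j).trace.re := by
  induction j with
  | zero => exact ⟨fun A => by simpa [pow_two] using norm_trace_sq_le A, fun A B _ _ => by simp⟩
  | succ j ih =>
    obtain ⟨ih1, ih2⟩ := ih
    constructor
    · intro A
      have hC : (Aᴴ * A).IsHermitian := isHermitian_conjTranspose_mul_self A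
      have hD : (A * Aᴴ).IsHermitian := isHermitian_mul_conjTranspose_self A
      have h1 := ih1 (A ^ 2)
      rw [← pow_mul, ← pow_succ'] at h1
      have h2 : (((A ^ 2)ᴴ * A ^ 2) ^ 2 ^ j).trace.re
          = ((Aᴴ * A * (A * Aᴴ)) ^ 2 ^ j).trace.re := by
        rw [pow_two, conjTranspose_mul, mul_assoc, trace_mul_pow_comm]
        simp only [mul_assoc]
      have h3 := ih2 _ _ hC hD
      -- A*A and AA* have equal traces of powers, so the two Cauchy–Schwarz factors coincide and
      -- their product has no square root left.
      have h4 := norm_trace_mul_mul_conjTranspose_le (PosSemidef.one (n := ι) (R := ℂ))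
        ((A * Aᴴ) ^ 2 ^ j) ((Aᴴ * A) ^ 2 ^ j)
      simp only [stateNorm, mul_one, (hD.pow _).eq, (hC.pow _).eq] at h4
      rw [← pow_add, ← pow_add, ← two_mul, ← pow_succ', trace_mul_pow_comm A Aᴴ,
        Real.mul_self_sqrt] at h4
      · exact h1.trans (h2.le.trans (h3.trans ((Complex.re_le_norm _).trans h4)))
      · have := (PosSemidef.one (n := ι) (R := ℂ)).re_trace_conj_nonneg ((Aᴴ * A) ^ 2 ^ j)
        rwa [mul_one, (hC.pow _).eq, ← pow_add, ← two_mul, ← pow_succ'] at this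
    · intro A B hA hB
      have h1 := ih1 (A * B)
      have h2 : (((A * B)ᴴ * (A * B)) ^ 2 ^ j).trace = ((A ^ 2 * B ^ 2) ^ 2 ^ j).trace := by
        rw [conjTranspose_mul, hA.eq, hB.eq, mul_assoc, trace_mul_pow_comm]
        simp only [pow_two, mul_assoc]
      have h3 := ih2 _ _ (hA.pow 2) (hB.pow 2)
      rw [← pow_mul, ← pow_mul, ← pow_succ'] at h3
      rw [h2] at h1
      exact (Complex.re_le_norm _).trans (h1.trans h3)

open Filter Topology in
open scoped Norms.L2Operator in
/-- The Golden–Thompson inequality. -/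
theorem golden_thompson [Nonempty ι] {X Y : Matrix ι ι ℂ} (hX : X.IsHermitian)
    (hY : Y.IsHermitian) :
    (NormedSpace.exp (X + Y)).trace.re ≤ (NormedSpace.exp X * NormedSpace.exp Y).trace.re := by
  -- The Lie–Trotter exponent is `n + 1`, so the index `2 ^ j - 1` gives the exponent `2 ^ j`.
  have hsub : Tendsto (fun j : ℕ => 2 ^ j - 1) atTop atTop :=
    (tendsto_sub_atTop_nat 1).comp (tendsto_pow_atTop_atTop_of_one_lt (by norm_num))
  have hlim := (tendsto_exp_mul_exp_pow X Y).comp hsub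
  have hc : Continuous fun A : Matrix ι ι ℂ => A.trace.re :=
    Complex.continuous_re.comp (continuous_id.matrix_trace)
  refine le_of_tendsto ((hc.tendsto _).comp hlim) (Eventually.of_forall fun j => ?_)
  have hj : (2 ^ j - 1 + 1 : ℕ) = 2 ^ j := Nat.sub_add_cancel Nat.one_le_two_pow
  have hjr : (((2 ^ j - 1 : ℕ) : ℝ) + 1) = ((2 ^ j : ℕ) : ℝ) := by rw [← hj]; push_cast; simp
  have hpow : ∀ Z : Matrix ι ι ℂ,
      NormedSpace.exp ((((2 ^ j : ℕ) : ℝ))⁻¹ • Z) ^ 2 ^ j = NormedSpace.exp Z := fun Z => by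
    rw [← Matrix.exp_nsmul, ← Nat.cast_smul_eq_nsmul ℝ, smul_smul, mul_inv_cancel₀, one_smul]
    positivity
  have hherm : ∀ {Z : Matrix ι ι ℂ}, Z.IsHermitian → ∀ r : ℝ, (r • Z).IsHermitian :=
    fun hZ r => by rw [IsHermitian, conjTranspose_smul, hZ.eq, star_trivial]
  have h := (trace_two_pow_aux (ι := ι) j).2 _ _ (hherm hX (((2 ^ j : ℕ) : ℝ))⁻¹).exp
    (hherm hY (((2 ^ j : ℕ) : ℝ))⁻¹).exp
  rw [hpow, hpow] at h
  simpa only [Function.comp, hj, hjr] using h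

end Matrix

/-! ### Spectral calculus, Peierls–Bogoliubov and the comparison of Gibbs weights. -/

namespace Matrix

variable {ι : Type*} [Fintype ι] [DecidableEq ι]

theorem IsHermitian.posDef_exp {X : Matrix ι ι ℂ} (hX : X.IsHermitian) :
    (NormedSpace.exp X).PosDef := by
  have hh : ((2 : ℂ)⁻¹ • X).IsHermitian := by
    rw [IsHermitian, conjTranspose_smul, hX.eq]; simp
  have e : NormedSpace.exp X
      = (NormedSpace.exp ((2 : ℂ)⁻¹ • X))ᴴ * NormedSpace.exp ((2 : ℂ)⁻¹ • X) := by
    rw [hh.exp.eq, ← exp_add_of_commute _ _ (Commute.refl _), ← add_smul]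
    norm_num
  rw [e]
  exact PosDef.conjTranspose_mul_self _ (mulVec_injective_of_isUnit (isUnit_exp _))

namespace IsHermitian

variable {A : Matrix ι ι ℂ} (hA : A.IsHermitian)

/-- The function `f` of a Hermitian matrix, defined through its diagonalization. -/
noncomputable def spectralMap (f : ℝ → ℝ) : Matrix ι ι ℂ :=
  (hA.eigenvectorUnitary : Matrix ι ι ℂ) * diagonal (fun i => (f (hA.eigenvalues i) : ℂ)) *
    (hA.eigenvectorUnitary : Matrix ι ι ℂ)ᴴ

theorem eigenvectorUnitary_conjTranspose_mul :
    (hA.eigenvectorUnitary : Matrix ι ι ℂ)ᴴ * hA.eigenvectorUnitary = 1 :=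
  Unitary.coe_star_mul_self hA.eigenvectorUnitary

theorem eigenvectorUnitary_mul_conjTranspose :
    (hA.eigenvectorUnitary : Matrix ι ι ℂ) * (hA.eigenvectorUnitary : Matrix ι ι ℂ)ᴴ = 1 :=
  Unitary.coe_mul_star_self hA.eigenvectorUnitary

theorem spectralMap_id : hA.spectralMap (fun x => x) = A := by
  conv_rhs => rw [hA.spectral_theorem, Unitary.conjStarAlgAut_apply]
  rfl

theorem spectralMap_mul (f g : ℝ → ℝ) :
    hA.spectralMap f * hA.spectralMap g = hA.spectralMap (fun x => f x * g x) := by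
  have h := hA.eigenvectorUnitary_conjTranspose_mul
  simp only [spectralMap]
  rw [mul_assoc, ← mul_assoc _ (_ * diagonal _), ← mul_assoc _ _ (diagonal _), h, one_mul,
    ← mul_assoc, mul_assoc _ (diagonal _) (diagonal _), diagonal_mul_diagonal]
  simp

theorem spectralMap_add (f g : ℝ → ℝ) :
    hA.spectralMap f + hA.spectralMap g = hA.spectralMap (fun x => f x + g x) := by
  simp only [spectralMap]
  rw [← add_mul, ← mul_add, diagonal_add]
  simp

theorem spectralMap_smul (r : ℝ) (f : ℝ → ℝ) :
    (r : ℂ) • hA.spectralMap f = hA.spectralMap (fun x => r * f x) := by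
  simp only [spectralMap]
  rw [← smul_mul, ← Matrix.mul_smul, ← diagonal_smul]
  simp [Pi.smul_def]

theorem spectralMap_one : hA.spectralMap (fun _ => 1) = 1 := by
  simp [spectralMap, hA.eigenvectorUnitary_mul_conjTranspose]

theorem isHermitian_spectralMap (f : ℝ → ℝ) : (hA.spectralMap f).IsHermitian := by
  have : (diagonal (fun i => (f (hA.eigenvalues i) : ℂ))).IsHermitian := by
    simp [IsHermitian, diagonal_conjTranspose, Pi.star_def]
  exact isHermitian_mul_mul_conjTranspose _ this

theorem exp_spectralMap (f : ℝ → ℝ) :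
    NormedSpace.exp (hA.spectralMap f) = hA.spectralMap (fun x => Real.exp (f x)) := by
  have h := hA.eigenvectorUnitary_mul_conjTranspose
  have hU : IsUnit (hA.eigenvectorUnitary : Matrix ι ι ℂ) :=
    (Unitary.toUnits hA.eigenvectorUnitary).isUnit
  have hinv : (hA.eigenvectorUnitary : Matrix ι ι ℂ)⁻¹
      = (hA.eigenvectorUnitary : Matrix ι ι ℂ)ᴴ := inv_eq_right_inv h
  simp only [spectralMap]
  rw [← hinv, exp_conj _ _ hU, exp_diagonal]
  congr 3
  ext i
  rw [Pi.exp_def, ← Complex.exp_eq_exp_ℂ, Complex.ofReal_exp]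

theorem exp_eq_spectralMap : NormedSpace.exp A = hA.spectralMap Real.exp := by
  conv_lhs => rw [← hA.spectralMap_id, hA.exp_spectralMap]

/-- In an eigenbasis of `A` the trace is a sum of values of `f` weighted by the diagonal of a
positive semidefinite matrix. -/
theorem re_trace_spectralMap_mul_le {M : Matrix ι ι ℂ} (hM : M.PosSemidef) {f g : ℝ → ℝ}
    (h : ∀ x, f x ≤ g x) :
    (hA.spectralMap f * M).trace.re ≤ (hA.spectralMap g * M).trace.re := by
  have key : ∀ f : ℝ → ℝ, (hA.spectralMap f * M).trace.re = ∑ i, f (hA.eigenvalues i) *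
      (((hA.eigenvectorUnitary : Matrix ι ι ℂ)ᴴ * M *
        (hA.eigenvectorUnitary : Matrix ι ι ℂ)) i i).re := fun f => by
    rw [spectralMap, mul_assoc, mul_assoc, trace_mul_comm, mul_assoc, trace, Complex.re_sum]
    refine Finset.sum_congr rfl fun i _ => ?_
    rw [diag_apply, diagonal_mul, Complex.re_ofReal_mul]
  rw [key, key]
  refine Finset.sum_le_sum fun i _ => mul_le_mul_of_nonneg_right (h _) ?_
  exact (Complex.nonneg_iff.1 ((hM.conjTranspose_mul_mul_same _).diag_nonneg (i := i))).1

/-- The weights are squared overlaps of the two eigenbases and do not depend on `f` and `g`, so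
scalar inequalities between eigenvalues sum to trace inequalities. -/
theorem re_trace_spectralMap_mul_spectralMap {B : Matrix ι ι ℂ} (hB : B.IsHermitian)
    (f g : ℝ → ℝ) :
    (hA.spectralMap f * hB.spectralMap g).trace.re = ∑ i, ∑ j, Complex.normSq
      (((hA.eigenvectorUnitary : Matrix ι ι ℂ)ᴴ * (hB.eigenvectorUnitary : Matrix ι ι ℂ)) i j) *
        (f (hA.eigenvalues i) * g (hB.eigenvalues j)) := by
  set U := (hA.eigenvectorUnitary : Matrix ι ι ℂ)
  set V := (hB.eigenvectorUnitary : Matrix ι ι ℂ)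
  have e : (hA.spectralMap f * hB.spectralMap g).trace
      = (diagonal (fun i => (f (hA.eigenvalues i) : ℂ)) * ((Uᴴ * V) *
          (diagonal (fun i => (g (hB.eigenvalues i) : ℂ)) * (Uᴴ * V)ᴴ))).trace := by
    simp only [spectralMap, conjTranspose_mul, conjTranspose_conjTranspose]
    rw [mul_assoc, mul_assoc, trace_mul_comm]
    simp only [mul_assoc]
    rfl
  rw [e, trace, Complex.re_sum]
  refine Finset.sum_congr rfl fun i _ => ?_
  rw [diag_apply, diagonal_mul, Complex.re_ofReal_mul, mul_apply, Complex.re_sum, Finset.mul_sum]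
  refine Finset.sum_congr rfl fun j _ => ?_
  rw [diagonal_mul, conjTranspose_apply, mul_left_comm, Complex.re_ofReal_mul]
  rw [RCLike.star_def, Complex.mul_conj, Complex.ofReal_re]
  ring

end IsHermitian

/-- The Peierls–Bogoliubov inequality. -/
theorem peierls_bogoliubov {K Y : Matrix ι ι ℂ} (hK : K.IsHermitian) (hY : Y.IsHermitian) {c : ℝ}
    (h : c * (NormedSpace.exp K).trace.re ≤ (Y * NormedSpace.exp K).trace.re) :
    Real.exp c * (NormedSpace.exp K).trace.re ≤ (NormedSpace.exp (K + Y)).trace.re := by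
  have hB : (K + Y).IsHermitian := hK.add hY
  have t1 := hK.re_trace_spectralMap_mul_spectralMap hB (fun _ => 1) Real.exp
  have t2 := hK.re_trace_spectralMap_mul_spectralMap hB Real.exp (fun _ => 1)
  have t3 := hK.re_trace_spectralMap_mul_spectralMap hB Real.exp (fun x => x)
  have t4 := hK.re_trace_spectralMap_mul_spectralMap hB (fun x => Real.exp x * x) (fun _ => 1)
  have e4 : hK.spectralMap (fun x => Real.exp x * x) = NormedSpace.exp K * K := by
    rw [hK.exp_eq_spectralMap, ← hK.spectralMap_mul, hK.spectralMap_id]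
  rw [hK.spectralMap_one, one_mul, ← hB.exp_eq_spectralMap] at t1
  rw [hB.spectralMap_one, mul_one, ← hK.exp_eq_spectralMap] at t2
  rw [hB.spectralMap_id, ← hK.exp_eq_spectralMap, mul_add, trace_add, Complex.add_re] at t3
  rw [hB.spectralMap_one, mul_one, e4] at t4
  rw [trace_mul_comm] at h
  have key : Real.exp c * ((1 - c) * (NormedSpace.exp K).trace.re
      + ((NormedSpace.exp K * K).trace.re + (NormedSpace.exp K * Y).trace.re)
      - (NormedSpace.exp K * K).trace.re) ≤ (NormedSpace.exp (K + Y)).trace.re := by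
    rw [t1, t2, t3, t4]
    simp only [Finset.mul_sum, ← Finset.sum_add_distrib, ← Finset.sum_sub_distrib]
    refine Finset.sum_le_sum fun i _ => Finset.sum_le_sum fun j _ => ?_
    have hw := Complex.normSq_nonneg
      (((hK.eigenvectorUnitary : Matrix ι ι ℂ)ᴴ * (hB.eigenvectorUnitary : Matrix ι ι ℂ)) i j)
    -- The exponential lies above its tangent at `c + hK.eigenvalues i`; the shift by `c` produces
    -- the factor `exp c`.
    have hexp : Real.exp (c + hK.eigenvalues i) *
        (hB.eigenvalues j - (c + hK.eigenvalues i) + 1) ≤ Real.exp (hB.eigenvalues j) := by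
      have h1 := Real.add_one_le_exp (hB.eigenvalues j - (c + hK.eigenvalues i))
      calc _ ≤ Real.exp (c + hK.eigenvalues i) *
            Real.exp (hB.eigenvalues j - (c + hK.eigenvalues i)) := by gcongr
        _ = _ := by rw [← Real.exp_add]; congr 1; ring
    have := mul_le_mul_of_nonneg_left hexp hw
    rw [Real.exp_add] at this
    refine le_trans (le_of_eq ?_) (this.trans (le_of_eq ?_)) <;> ring
  refine le_trans ?_ key
  have := Real.exp_pos c
  gcongr
  linarith

/-- Two Gibbs weights `exp K` and `exp (K + Y)` with equal partition functions and with bounded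
energy difference give comparable probabilities, in the logarithmic scale, to every event of the
measurement of `A`. -/
theorem exp_mul_trace_exp_le_of_event [Nonempty ι] {A K Y : Matrix ι ι ℂ} (hA : A.IsHermitian)
    (hK : K.IsHermitian) (hY : Y.IsHermitian) {f : ℝ → ℝ} (hf : ∀ x, f x = 0 ∨ f x = 1)
    {p v : ℝ} (hp : 0 < p) (hv : 0 ≤ v)
    (hZ : (NormedSpace.exp (K + Y)).trace.re = (NormedSpace.exp K).trace.re)
    (hpK : p * (NormedSpace.exp K).trace.re ≤ (hA.spectralMap f * NormedSpace.exp K).trace.re)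
    (hvK : -v * (NormedSpace.exp K).trace.re ≤ (Y * NormedSpace.exp K).trace.re) :
    Real.exp (-((v + Real.log 2) / p)) * (NormedSpace.exp (K + Y)).trace.re
      ≤ (hA.spectralMap f * NormedSpace.exp (K + Y)).trace.re := by
  -- The tilt is chosen so that the mean of `Y + s • E` is at least -v + s p = log 2, which makes
  -- the tilted partition function at least twice the original.
  set s := (v + Real.log 2) / p with hs
  have hs0 : 0 ≤ s := div_nonneg (add_nonneg hv (Real.log_nonneg (by norm_num))) hp.le
  have hE : ((s : ℂ) • hA.spectralMap f).IsHermitian := by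
    rw [hA.spectralMap_smul]; exact hA.isHermitian_spectralMap _
  have hPB : Real.log 2 * (NormedSpace.exp K).trace.re
      ≤ ((Y + (s : ℂ) • hA.spectralMap f) * NormedSpace.exp K).trace.re := by
    rw [add_mul, trace_add, Complex.add_re, smul_mul, trace_smul, smul_eq_mul,
      Complex.re_ofReal_mul]
    have h1 := mul_le_mul_of_nonneg_left hpK hs0
    have h2 : s * p = v + Real.log 2 := by rw [hs]; field_simp
    rw [← mul_assoc, h2] at h1
    linarith
  have h1 := peierls_bogoliubov hK (hY.add hE) hPB
  rw [Real.exp_log (by norm_num), ← add_assoc] at h1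
  have h2 := golden_thompson (hK.add hY) hE
  -- The event is a projection, so its exponential is affine in it. Golden–Thompson then gives 2Z ≤
  -- Z + (exp s - 1) q, where q is the unnormalized weight of the event.
  have hexp : NormedSpace.exp ((s : ℂ) • hA.spectralMap f)
      = 1 + ((Real.exp s - 1 : ℝ) : ℂ) • hA.spectralMap f := by
    rw [hA.spectralMap_smul, hA.exp_spectralMap, hA.spectralMap_smul, ← hA.spectralMap_one,
      hA.spectralMap_add]
    congr 1
    ext x
    rcases hf x with h | h <;> simp [h]
  rw [hexp, mul_add, mul_one, trace_add, Complex.add_re, Matrix.mul_smul, trace_smul, smul_eq_mul,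
    Complex.re_ofReal_mul, trace_mul_comm _ (hA.spectralMap f)] at h2
  have hq : 0 ≤ (hA.spectralMap f * NormedSpace.exp (K + Y)).trace.re := by
    have := hA.re_trace_spectralMap_mul_le (hK.add hY).posDef_exp.posSemidef
      (f := fun _ => 0) (g := f) (fun x => by rcases hf x with h | h <;> simp [h])
    refine le_trans (le_of_eq ?_) this
    simp [IsHermitian.spectralMap]
  rw [Real.exp_neg, inv_mul_le_iff₀ (Real.exp_pos s)]
  linarith

end Matrix

/-! ### Commutation signs of Pauli products and their orthogonality. -/

open Matrix

instance : Fintype Pauli where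
  elems := {Pauli.I, Pauli.X, Pauli.Y, Pauli.Z}
  complete := fun p => by cases p <;> decide

namespace Pauli

/-- The sign `±1` with which two Pauli matrices commute. -/
def sign (p q : Pauli) : ℤ := if p = I ∨ q = I ∨ p = q then 1 else -1

theorem toMatrix_mul_comm (p q : Pauli) :
    p.toMatrix * q.toMatrix = (p.sign q : ℂ) • (q.toMatrix * p.toMatrix) := by
  cases p <;> cases q <;> ext i j <;> fin_cases i <;> fin_cases j <;>
    simp [Pauli.toMatrix, sign, Matrix.mul_apply, Fin.sum_univ_two]

theorem toMatrix_mul_self (p : Pauli) : p.toMatrix * p.toMatrix = 1 := by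
  cases p <;> ext i j <;> fin_cases i <;> fin_cases j <;>
    simp [Pauli.toMatrix, Matrix.mul_apply, Fin.sum_univ_two]

theorem star_toMatrix_apply (p : Pauli) (x y : Fin 2) :
    star (p.toMatrix y x) = p.toMatrix x y := by
  cases p <;> fin_cases x <;> fin_cases y <;> simp [Pauli.toMatrix]

theorem sum_sign_mul_sign (p q : Pauli) :
    ∑ u : Pauli, u.sign p * u.sign q = if p = q then 4 else 0 := by
  revert p q; decide

theorem sign_eq_one_or (p q : Pauli) : p.sign q = 1 ∨ p.sign q = -1 := by
  unfold sign; split <;> simp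

theorem sign_I_left (q : Pauli) : I.sign q = 1 := by simp [sign]

theorem sign_I_right (p : Pauli) : p.sign I = 1 := by simp [sign]

end Pauli

namespace PauliString

variable {n : ℕ}

/-- The sign `±1` with which two Pauli products commute. -/
def sign (P Q : PauliString n) : ℤ := ∏ i, (P i).sign (Q i)

theorem toMatrix_mul_apply (P Q : PauliString n) (x y : Fin n → Fin 2) :
    (P.toMatrix * Q.toMatrix) x y = ∏ i, ((P i).toMatrix * (Q i).toMatrix) (x i) (y i) := by
  simp only [Matrix.mul_apply, toMatrix, Matrix.of_apply, Finset.prod_univ_sum,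
    Fintype.piFinset_univ, Finset.prod_mul_distrib]

theorem toMatrix_mul_comm (P Q : PauliString n) :
    P.toMatrix * Q.toMatrix = (P.sign Q : ℂ) • (Q.toMatrix * P.toMatrix) := by
  ext x y
  rw [Matrix.smul_apply, toMatrix_mul_apply, toMatrix_mul_apply, sign, Int.cast_prod, smul_eq_mul,
    ← Finset.prod_mul_distrib]
  refine Finset.prod_congr rfl fun i _ => ?_
  rw [Pauli.toMatrix_mul_comm, Matrix.smul_apply, smul_eq_mul]

theorem toMatrix_mul_self (P : PauliString n) : P.toMatrix * P.toMatrix = 1 := by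
  ext x y
  rw [toMatrix_mul_apply, Matrix.one_apply]
  simp only [Pauli.toMatrix_mul_self, Matrix.one_apply]
  rw [Finset.prod_ite_zero]
  simp [funext_iff]

theorem isHermitian_toMatrix (P : PauliString n) : P.toMatrix.IsHermitian := by
  ext x y
  rw [conjTranspose_apply, toMatrix, Matrix.of_apply, Matrix.of_apply, star_prod]
  exact Finset.prod_congr rfl fun i _ => Pauli.star_toMatrix_apply _ _ _

theorem conjTranspose_mul_toMatrix (P : PauliString n) : P.toMatrixᴴ * P.toMatrix = 1 := by
  rw [P.isHermitian_toMatrix.eq, toMatrix_mul_self]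

theorem isUnit_toMatrix (P : PauliString n) : IsUnit P.toMatrix :=
  IsUnit.of_mul_eq_one _ P.toMatrix_mul_self

theorem inv_toMatrix (P : PauliString n) : P.toMatrix⁻¹ = P.toMatrix :=
  inv_eq_right_inv P.toMatrix_mul_self

theorem conj_toMatrix (U P : PauliString n) :
    U.toMatrix * P.toMatrix * U.toMatrix = (U.sign P : ℂ) • P.toMatrix := by
  rw [toMatrix_mul_comm, smul_mul, mul_assoc, toMatrix_mul_self, mul_one]

theorem sign_eq_one_or (P Q : PauliString n) : P.sign Q = 1 ∨ P.sign Q = -1 := by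
  refine Finset.prod_induction _ (fun z : ℤ => z = 1 ∨ z = -1) ?_ (Or.inl rfl)
    fun i _ => Pauli.sign_eq_one_or _ _
  rintro a b (rfl | rfl) (rfl | rfl) <;> simp

theorem norm_sign_sub_one_le (P Q : PauliString n) : ‖(P.sign Q : ℂ) - 1‖ ≤ 2 := by
  rcases P.sign_eq_one_or Q with h | h <;> norm_num [h]

theorem stateNorm_toMatrix_mul (P : PauliString n)
    (M X : Matrix (Fin n → Fin 2) (Fin n → Fin 2) ℂ) :
    stateNorm M (P.toMatrix * X) = stateNorm M X :=
  stateNorm_unitary_mul P.conjTranspose_mul_toMatrix X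

theorem stateNorm_toMatrix (P : PauliString n)
    {M : Matrix (Fin n → Fin 2) (Fin n → Fin 2) ℂ} (htr : M.trace = 1) :
    stateNorm M P.toMatrix = 1 := by
  rw [← mul_one P.toMatrix, stateNorm_toMatrix_mul]
  simp [stateNorm, htr]

theorem mem_support {P : PauliString n} {i : Fin n} : i ∈ P.support ↔ P i ≠ Pauli.I := by
  simp [support]

theorem support_nonempty {P : PauliString n} (hP : P ≠ identity n) : P.support.Nonempty := by
  by_contra h
  refine hP (funext fun i => ?_)
  by_contra hi
  exact h ⟨i, mem_support.2 hi⟩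

theorem sign_eq_one_of_disjoint {P Q : PauliString n}
    (h : ¬ (P.support ∩ Q.support).Nonempty) : P.sign Q = 1 := by
  refine Finset.prod_eq_one fun i _ => ?_
  by_cases hP : P i = Pauli.I
  · rw [hP, Pauli.sign_I_left]
  · by_cases hQ : Q i = Pauli.I
    · rw [hQ, Pauli.sign_I_right]
    · exact (h ⟨i, Finset.mem_inter.2 ⟨mem_support.2 hP, mem_support.2 hQ⟩⟩).elim

/-- The Pauli products supported in `S`. -/
def supportedIn (S : Finset (Fin n)) : Finset (PauliString n) :=
  Fintype.piFinset fun i => if i ∈ S then Finset.univ else {Pauli.I}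

theorem support_subset_of_mem {S : Finset (Fin n)} {U : PauliString n}
    (hU : U ∈ supportedIn S) : U.support ⊆ S := by
  intro i hi
  by_contra hS
  have := Fintype.mem_piFinset.1 hU i
  rw [if_neg hS, Finset.mem_singleton] at this
  exact mem_support.1 hi this

theorem identity_mem_supportedIn (S : Finset (Fin n)) : identity n ∈ supportedIn S :=
  Fintype.mem_piFinset.2 fun i => by split <;> simp [identity]

/-- Orthogonality of the sign characters of the Pauli group on `S`. -/
theorem sum_sign_mul_sign_eq_zero {S : Finset (Fin n)} {P Q : PauliString n}
    (h : ∃ i ∈ S, P i ≠ Q i) : ∑ U ∈ supportedIn S, U.sign P * U.sign Q = 0 := by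
  simp only [sign, ← Finset.prod_mul_distrib]
  rw [supportedIn, ← Finset.prod_univ_sum (fun i => if i ∈ S then Finset.univ else {Pauli.I})
    (fun i u => u.sign (P i) * u.sign (Q i))]
  obtain ⟨i, hi, hne⟩ := h
  refine Finset.prod_eq_zero (Finset.mem_univ i) ?_
  rw [if_pos hi, Pauli.sum_sign_mul_sign, if_neg hne]

theorem sum_sign_mul_sign_self (S : Finset (Fin n)) (P : PauliString n) :
    ∑ U ∈ supportedIn S, U.sign P * U.sign P = (supportedIn S).card := by
  rw [Finset.card_eq_sum_ones, Nat.cast_sum]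
  refine Finset.sum_congr rfl fun U _ => ?_
  rcases U.sign_eq_one_or P with h | h <;> simp [h]

end PauliString

/-! ### Counting terms near a set of qubits, and isolating one term. -/

namespace PauliSum

variable {n m : ℕ}

theorem isHermitian_op (A : PauliSum n m) : A.op.IsHermitian := by
  rw [IsHermitian, op, conjTranspose_sum]
  refine Finset.sum_congr rfl fun a _ => ?_
  rw [conjTranspose_smul, (A.term a).isHermitian_toMatrix.eq]
  simp

/-- The terms whose support meets `S`. -/
def meeting (A : PauliSum n m) (S : Finset (Fin n)) : Finset (Fin m) :=
  Finset.univ.filter fun a => ((A.term a).support ∩ S).Nonempty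

theorem mem_meeting {A : PauliSum n m} {S : Finset (Fin n)} {a : Fin m} :
    a ∈ A.meeting S ↔ ((A.term a).support ∩ S).Nonempty := by simp [meeting]

theorem card_meeting_support_le (A : PauliSum n m) {d : ℕ} (hd : A.dualGraph.maxDegree ≤ d)
    (b : Fin m) : (A.meeting (A.term b).support).card ≤ d + 1 := by
  have hsub : A.meeting (A.term b).support ⊆ insert b (A.dualGraph.neighborFinset b) := by
    intro a ha
    rw [Finset.mem_insert, SimpleGraph.mem_neighborFinset]
    by_cases h : a = b
    · exact Or.inl h
    · refine Or.inr ⟨Ne.symm h, ?_⟩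
      rw [Finset.inter_comm]
      exact mem_meeting.1 ha
  calc _ ≤ _ := Finset.card_le_card hsub
    _ ≤ (A.dualGraph.neighborFinset b).card + 1 := Finset.card_insert_le _ _
    _ ≤ d + 1 := by
      rw [SimpleGraph.card_neighborFinset_eq_degree]
      exact Nat.add_le_add_right ((A.dualGraph.degree_le_maxDegree b).trans hd) 1

/-- Terms through a common qubit form a clique, so all of them lie in the closed neighborhood of any
one. -/
theorem card_meeting_singleton_le (A : PauliSum n m) {d : ℕ} (hd : A.dualGraph.maxDegree ≤ d)
    (i : Fin n) : (A.meeting {i}).card ≤ d + 1 := by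
  rcases (A.meeting {i}).eq_empty_or_nonempty with h | ⟨b, hb⟩
  · simp [h]
  · refine (Finset.card_le_card fun a ha => ?_).trans (A.card_meeting_support_le hd b)
    have hi : ∀ {a}, a ∈ A.meeting {i} → i ∈ (A.term a).support := fun h => by
      obtain ⟨j, hj⟩ := mem_meeting.1 h
      rw [Finset.mem_inter, Finset.mem_singleton] at hj
      exact hj.2 ▸ hj.1
    exact mem_meeting.2 ⟨i, Finset.mem_inter.2 ⟨hi ha, hi hb⟩⟩

theorem card_meeting_le (A : PauliSum n m) {d : ℕ} (hd : A.dualGraph.maxDegree ≤ d)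
    (S : Finset (Fin n)) : (A.meeting S).card ≤ S.card * (d + 1) := by
  have hsub : A.meeting S ⊆ S.biUnion fun i => A.meeting {i} := by
    intro a ha
    obtain ⟨i, hi⟩ := mem_meeting.1 ha
    rw [Finset.mem_inter] at hi
    exact Finset.mem_biUnion.2 ⟨i, hi.2, mem_meeting.2 ⟨i, by simpa using hi.1⟩⟩
  exact (Finset.card_le_card hsub).trans
    (Finset.card_biUnion_le_card_mul _ _ _ fun i _ => A.card_meeting_singleton_le hd i)

/-- The union of the supports of the terms that meet the support of the term `b`. -/
def neighborhood (A : PauliSum n m) (b : Fin m) : Finset (Fin n) :=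
  (A.meeting (A.term b).support).biUnion fun a => (A.term a).support

theorem card_neighborhood_le (A : PauliSum n m) {k d : ℕ} (hk : A.IsLocal k)
    (hd : A.dualGraph.maxDegree ≤ d) (b : Fin m) : (A.neighborhood b).card ≤ (d + 1) * k :=
  (Finset.card_biUnion_le_card_mul _ _ k fun a _ => hk a).trans
    (Nat.mul_le_mul_right k (A.card_meeting_support_le hd b))

theorem conj_op_sub_op (A : PauliSum n m) (U : PauliString n) :
    U.toMatrix * A.op * U.toMatrix - A.op =
      ∑ a, ((A.coeff a : ℂ) * ((U.sign (A.term a) : ℂ) - 1)) • (A.term a).toMatrix := by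
  rw [op, Finset.mul_sum, Finset.sum_mul, ← Finset.sum_sub_distrib]
  refine Finset.sum_congr rfl fun a _ => ?_
  rw [Matrix.mul_smul, Matrix.smul_mul, PauliString.conj_toMatrix, smul_smul, ← sub_smul]
  congr 1
  ring

theorem sign_eq_one_of_notMem_meeting {A : PauliSum n m} {S : Finset (Fin n)} {U : PauliString n}
    (hU : U ∈ PauliString.supportedIn S) {a : Fin m} (ha : a ∉ A.meeting S) :
    U.sign (A.term a) = 1 := by
  refine PauliString.sign_eq_one_of_disjoint fun h => ha (mem_meeting.2 (h.mono ?_))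
  rw [Finset.inter_comm]
  exact Finset.inter_subset_inter_left (PauliString.support_subset_of_mem hU)

theorem conj_op_sub_op_eq_sum_meeting (A : PauliSum n m) {S : Finset (Fin n)} {U : PauliString n}
    (hU : U ∈ PauliString.supportedIn S) :
    U.toMatrix * A.op * U.toMatrix - A.op = ∑ a ∈ A.meeting S,
      ((A.coeff a : ℂ) * ((U.sign (A.term a) : ℂ) - 1)) • (A.term a).toMatrix := by
  rw [conj_op_sub_op]
  refine (Finset.sum_subset (Finset.subset_univ _) fun a _ ha => ?_).symm
  simp [sign_eq_one_of_notMem_meeting hU ha]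

theorem term_ne_identity_of_mem_meeting {A : PauliSum n m} {S : Finset (Fin n)} {a : Fin m}
    (ha : a ∈ A.meeting S) : A.term a ≠ PauliString.identity n := by
  intro h
  obtain ⟨i, hi⟩ := mem_meeting.1 ha
  exact PauliString.mem_support.1 (Finset.mem_inter.1 hi).1 (by rw [h]; rfl)

theorem norm_coeff_mul_sign_sub_one_le {A : PauliSum n m} {S : Finset (Fin n)}
    (hA : ∀ a, A.term a ≠ PauliString.identity n → |A.coeff a| ≤ 1) (U : PauliString n)
    {a : Fin m} (ha : a ∈ A.meeting S) :
    ‖(A.coeff a : ℂ) * ((U.sign (A.term a) : ℂ) - 1)‖ ≤ 2 := by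
  rw [norm_mul, Complex.norm_real, Real.norm_eq_abs]
  calc _ ≤ 1 * 2 := mul_le_mul (hA a (term_ne_identity_of_mem_meeting ha))
        (PauliString.norm_sign_sub_one_le _ _) (norm_nonneg _) zero_le_one
    _ = 2 := one_mul 2

/-- Conjugation by the Pauli products on the neighborhood of a term isolates that term. -/
theorem sum_sign_smul_conj_op_sub_op (A : PauliSum n m) {b : Fin m}
    (hb : A.term b ≠ PauliString.identity n) :
    ∑ U ∈ PauliString.supportedIn (A.neighborhood b),
      (U.sign (A.term b) : ℂ) • (U.toMatrix * A.op * U.toMatrix - A.op) =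
    (((PauliString.supportedIn (A.neighborhood b)).card : ℂ) * (A.coeff b : ℂ)) •
      (A.term b).toMatrix := by
  obtain ⟨i, hi⟩ := PauliString.support_nonempty hb
  have hbS : (A.term b).support ⊆ A.neighborhood b :=
    Finset.subset_biUnion_of_mem (fun a => (A.term a).support)
      (mem_meeting.2 (by rw [Finset.inter_self]; exact ⟨i, hi⟩))
  have h1 : ∑ U ∈ PauliString.supportedIn (A.neighborhood b), U.sign (A.term b) = 0 := by
    have := PauliString.sum_sign_mul_sign_eq_zero (S := A.neighborhood b) (P := A.term b)
      (Q := PauliString.identity n) ⟨i, hbS hi, PauliString.mem_support.1 hi⟩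
    simpa [PauliString.sign, PauliString.identity, Pauli.sign_I_right] using this
  have h2 : ∀ a, a ≠ b → ∑ U ∈ PauliString.supportedIn (A.neighborhood b),
      U.sign (A.term b) * U.sign (A.term a) = 0 := by
    intro a hab
    refine PauliString.sum_sign_mul_sign_eq_zero ?_
    -- If `a` agreed with `b` on the neighborhood, it would meet the support of `b`, hence be
    -- supported in the neighborhood, and so equal `b` everywhere. The support of `b` alone would
    -- not separate them.
    by_contra! hcon
    have ha : a ∈ A.meeting (A.term b).support := by
      refine mem_meeting.2 ⟨i, Finset.mem_inter.2 ⟨?_, hi⟩⟩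
      rw [PauliString.mem_support, ← hcon i (hbS hi)]
      exact PauliString.mem_support.1 hi
    have haS : (A.term a).support ⊆ A.neighborhood b :=
      Finset.subset_biUnion_of_mem (fun a => (A.term a).support) ha
    refine hab (A.term_injective (funext fun j => ?_))
    by_cases hj : j ∈ A.neighborhood b
    · exact (hcon j hj).symm
    · have e : ∀ {P : PauliString n}, P.support ⊆ A.neighborhood b → P j = Pauli.I := fun hP => by
        by_contra h
        exact hj (hP (PauliString.mem_support.2 h))
      rw [e haS, e hbS]
  simp only [conj_op_sub_op, Finset.smul_sum, smul_smul]
  rw [Finset.sum_comm, Finset.sum_eq_single b]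
  · rw [← Finset.sum_smul]
    congr 1
    have h3 := PauliString.sum_sign_mul_sign_self (A.neighborhood b) (A.term b)
    calc _ = (A.coeff b : ℂ) * (((∑ U ∈ PauliString.supportedIn (A.neighborhood b),
          U.sign (A.term b) * U.sign (A.term b) : ℤ) : ℂ) -
          ((∑ U ∈ PauliString.supportedIn (A.neighborhood b), U.sign (A.term b) : ℤ) : ℂ)) := by
          push_cast
          rw [← Finset.sum_sub_distrib, Finset.mul_sum]
          exact Finset.sum_congr rfl fun U _ => by ring
      _ = _ := by rw [h1, h3]; push_cast; ring
  · intro a _ hab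
    rw [← Finset.sum_smul]
    have : ∑ U ∈ PauliString.supportedIn (A.neighborhood b), (U.sign (A.term b) : ℂ) *
        ((A.coeff a : ℂ) * ((U.sign (A.term a) : ℂ) - 1)) = 0 := by
      calc _ = (A.coeff a : ℂ) * (((∑ U ∈ PauliString.supportedIn (A.neighborhood b),
          U.sign (A.term b) * U.sign (A.term a) : ℤ) : ℂ) -
          ((∑ U ∈ PauliString.supportedIn (A.neighborhood b), U.sign (A.term b) : ℤ) : ℂ)) := by
            push_cast
            rw [← Finset.sum_sub_distrib, Finset.mul_sum]
            exact Finset.sum_congr rfl fun U _ => by ring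
        _ = 0 := by rw [h1, h2 a hab]; simp
    rw [this, zero_smul]
  · simp

/-- Some Pauli product on the neighborhood of a term moves `A` by at least the coefficient of that
term. -/
theorem exists_abs_coeff_le_stateNorm (A : PauliSum n m) {b : Fin m}
    (hb : A.term b ≠ PauliString.identity n) {M : Matrix (Fin n → Fin 2) (Fin n → Fin 2) ℂ}
    (hM : M.PosSemidef) (htr : M.trace = 1) :
    ∃ U ∈ PauliString.supportedIn (A.neighborhood b),
      |A.coeff b| ≤ stateNorm M (U.toMatrix * A.op * U.toMatrix - A.op) := by
  refine Finset.exists_le_of_sum_le ⟨_, PauliString.identity_mem_supportedIn _⟩ ?_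
  have h := congrArg (stateNorm M) (A.sum_sign_smul_conj_op_sub_op hb)
  rw [stateNorm_smul hM, PauliString.stateNorm_toMatrix _ htr, mul_one, norm_mul, Complex.norm_natCast, Complex.norm_real,
    Real.norm_eq_abs] at h
  rw [Finset.sum_const, nsmul_eq_mul, ← h]
  refine (stateNorm_sum_le hM _ _).trans (Finset.sum_le_sum fun U _ => ?_)
  rw [stateNorm_smul hM]
  rcases U.sign_eq_one_or (A.term b) with h | h <;> simp [h]

end PauliSum

/-! ### Paley–Zygmund argument in the conjugated state. -/

namespace Matrix

variable {ι : Type*} [Fintype ι] [DecidableEq ι]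

theorem stateNorm_conj_spectralMap {A M U : Matrix ι ι ℂ} (hA : A.IsHermitian)
    (hU : U.IsHermitian) (hUU : U * U = 1) (hM : M.PosSemidef) (g : ℝ → ℝ) :
    stateNorm M (U * hA.spectralMap g * U) ^ 2
      = (hA.spectralMap (fun x => g x * g x) * (U * M * U)).trace.re := by
  have e : (U * hA.spectralMap g * U * M * (U * hA.spectralMap g * U)ᴴ).trace
      = (hA.spectralMap g * hA.spectralMap g * (U * M * U)).trace := by
    rw [conjTranspose_mul, conjTranspose_mul, hU.eq, (hA.isHermitian_spectralMap g).eq]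
    set T := hA.spectralMap g
    calc (U * T * U * M * (U * (T * U))).trace = (U * T * U * M * U * T * U).trace := by
          simp only [mul_assoc]
      _ = (U * U * (T * U * M * U * T)).trace := by
          rw [trace_mul_comm]; simp only [mul_assoc]
      _ = (T * (T * U * M * U)).trace := by rw [hUU, one_mul, trace_mul_comm]
      _ = _ := by simp only [mul_assoc]
  rw [sq_stateNorm hM, e, hA.spectralMap_mul]

/-- If `A` is small in the state `M` but its conjugate `U A U` is not, and the commutation between
them is controlled, then in the conjugate state the measurement of `A` gives a large value with
probability bounded below. -/
theorem le_trace_indicator_conj {A M U : Matrix ι ι ℂ} (hA : A.IsHermitian) (hU : U.IsHermitian)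
    (hUU : U * U = 1) (hM : M.PosSemidef) (htr : M.trace = 1) {G : ℝ} (hG : 0 < G)
    (hsmall : stateNorm M A ≤ 1 / 4) (hlarge : 1 ≤ stateNorm M (U * A * U - A))
    (hcomm : stateNorm M (U * A * U * (U * A * U - A)) ≤ G) :
    1 / (4 * G ^ 2) ≤
      (hA.spectralMap (fun x => if |x| < 1 / 4 then 0 else 1) * (U * M * U)).trace.re := by
  set f : ℝ → ℝ := fun x => if |x| < 1 / 4 then 0 else 1 with hf
  set B := U * A * U with hB
  set D := B - A with hD
  set p := (hA.spectralMap f * (U * M * U)).trace.re with hp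
  have hBh : B.IsHermitian := by
    rw [hB, IsHermitian, conjTranspose_mul, conjTranspose_mul, hU.eq, hA.eq, mul_assoc]
  have hDh : D.IsHermitian := hBh.sub hA
  set E := U * hA.spectralMap f * U with hE
  set F := U * hA.spectralMap (fun x => x * (1 - f x)) * U with hF
  have hEp : stateNorm M E ^ 2 = p := by
    rw [hE, stateNorm_conj_spectralMap hA hU hUU hM]
    have : (fun x => f x * f x) = f := by
      ext x
      simp only [hf]
      split_ifs <;> norm_num
    rw [this]
  have hMU : (U * M * U).PosSemidef := by
    have := hM.mul_mul_conjTranspose_same U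
    rwa [hU.eq] at this
  have hFsmall : stateNorm M F ≤ 1 / 4 := by
    refine abs_le_of_sq_le_sq' ?_ (by norm_num) |>.2
    rw [hF, stateNorm_conj_spectralMap hA hU hUU hM]
    refine (hA.re_trace_spectralMap_mul_le hMU (g := fun _ => (1 / 4) ^ 2 * 1) fun x => ?_).trans ?_
    · by_cases h : |x| < 1 / 4
      · have := (sq_lt_sq₀ (abs_nonneg x) (by norm_num)).2 h
        rw [sq_abs] at this
        simp only [hf, if_pos h]
        linarith
      · simp only [hf, if_neg h]
        norm_num
    · rw [← hA.spectralMap_smul, hA.spectralMap_one, smul_mul, one_mul, trace_smul, trace_mul_comm,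
        ← mul_assoc, hUU, one_mul, htr]
      norm_num
  -- `E` is the event |B| ≥ 1/4 and `F` the part of `B` below that threshold.
  have hsplit : B = B * E + F := by
    have h1 : B * E = U * hA.spectralMap (fun x => x * f x) * U := by
      rw [hB, hE, ← hA.spectralMap_mul, hA.spectralMap_id]
      calc _ = U * A * (U * U) * hA.spectralMap f * U := by simp only [mul_assoc]
        _ = _ := by rw [hUU]; simp only [mul_assoc, mul_one]
    rw [h1, hF, ← add_mul, ← mul_add, hA.spectralMap_add]
    have : (fun x => x * f x + x * (1 - f x)) = fun x => x := by
      ext x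
      ring
    rw [this, hA.spectralMap_id]
  have hEsq : stateNorm M E = √p := by rw [← hEp, Real.sqrt_sq (stateNorm_nonneg _ _)]
  have hlow : stateNorm M D ^ 2 - stateNorm M D * (1 / 4) ≤ (B * M * Dᴴ).trace.re := by
    have e : B = D + A := by rw [hD]; abel
    have h1 : (B * M * Dᴴ).trace.re = stateNorm M D ^ 2 + (A * M * Dᴴ).trace.re := by
      rw [sq_stateNorm hM, ← Complex.add_re, ← trace_add, ← add_mul, ← add_mul, ← e]
    have h2 := (Complex.abs_re_le_norm _).trans (norm_trace_mul_mul_conjTranspose_le hM D A)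
    have h3 := mul_le_mul_of_nonneg_left hsmall (stateNorm_nonneg M D)
    have := neg_abs_le (A * M * Dᴴ).trace.re
    linarith
  -- `B` is moved from `E` onto `D`, so that only the norm of `B * D` is needed and not the
  -- unbounded norm of `B`.
  have hup : (B * M * Dᴴ).trace.re ≤ G * √p + stateNorm M D * (1 / 4) := by
    have h1 : (B * M * Dᴴ).trace = (E * M * (B * D)ᴴ).trace + (F * M * Dᴴ).trace := by
      have : (E * M * (B * D)ᴴ).trace = (B * E * M * Dᴴ).trace := by
        rw [conjTranspose_mul, hBh.eq, ← mul_assoc, trace_mul_comm]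
        simp only [mul_assoc]
      rw [this, ← trace_add, ← add_mul, ← add_mul, ← hsplit]
    rw [h1, Complex.add_re]
    have h2 := (Complex.re_le_norm _).trans (norm_trace_mul_mul_conjTranspose_le hM (B * D) E)
    have h3 := (Complex.re_le_norm _).trans (norm_trace_mul_mul_conjTranspose_le hM D F)
    have h4 := mul_le_mul_of_nonneg_left hFsmall (stateNorm_nonneg M D)
    have h5 := mul_le_mul_of_nonneg_right hcomm (stateNorm_nonneg M E)
    rw [hEsq] at h2 h5
    linarith
  -- The two bounds give ‖D‖² - ‖D‖/2 ≤ G√p, and the left side is at least 1/2 once ‖D‖ ≥ 1.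
  have hmain : 1 / 2 ≤ G * √p := by nlinarith
  have hp0 : 0 ≤ p := (sq_nonneg _).trans hEp.le
  have hsq := mul_self_le_mul_self (by norm_num) hmain
  rw [mul_mul_mul_comm, Real.mul_self_sqrt hp0] at hsq
  rw [div_le_iff₀ (by positivity)]
  nlinarith

end Matrix

/-! ### Displacement and energy bounds, and the estimate for Gibbs states. -/

namespace PauliString

variable {n : ℕ}

/-- A Pauli product has expectation at most the total weight in every positive functional. -/
theorem norm_trace_toMatrix_mul_le (P : PauliString n)
    {M : Matrix (Fin n → Fin 2) (Fin n → Fin 2) ℂ} (hM : M.PosSemidef) :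
    ‖(P.toMatrix * M).trace‖ ≤ M.trace.re := by
  have h := norm_trace_mul_mul_conjTranspose_le hM 1 P.toMatrix
  rw [← mul_one P.toMatrix, stateNorm_toMatrix_mul] at h
  simp only [stateNorm, one_mul, conjTranspose_one, mul_one] at h
  rwa [Real.mul_self_sqrt (Complex.nonneg_iff.1 hM.trace_nonneg).1] at h

end PauliString

namespace PauliSum

variable {n m : ℕ}

section Displacement

variable {A : PauliSum n m} {S : Finset (Fin n)} {U : PauliString n}
  {M : Matrix (Fin n → Fin 2) (Fin n → Fin 2) ℂ} {N : ℕ}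

theorem stateNorm_conj_op_sub_op_mul_le
    (hA : ∀ a, A.term a ≠ PauliString.identity n → |A.coeff a| ≤ 1)
    (hU : U ∈ PauliString.supportedIn S) (hN : (A.meeting S).card ≤ N) (hM : M.PosSemidef)
    (X : Matrix (Fin n → Fin 2) (Fin n → Fin 2) ℂ) :
    stateNorm M ((U.toMatrix * A.op * U.toMatrix - A.op) * X) ≤ 2 * N * stateNorm M X := by
  rw [conj_op_sub_op_eq_sum_meeting A hU, Finset.sum_mul]
  have hX := stateNorm_nonneg M X
  calc _ ≤ ∑ a ∈ A.meeting S, 2 * stateNorm M X := by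
        refine (stateNorm_sum_le hM _ _).trans (Finset.sum_le_sum fun a ha => ?_)
        rw [smul_mul, stateNorm_smul hM, PauliString.stateNorm_toMatrix_mul]
        exact mul_le_mul_of_nonneg_right (norm_coeff_mul_sign_sub_one_le hA U ha) hX
    _ = (A.meeting S).card * (2 * stateNorm M X) := by rw [Finset.sum_const, nsmul_eq_mul]
    _ ≤ N * (2 * stateNorm M X) := by gcongr
    _ = _ := by ring

/-- Only neighbors of `a` in the dual graph can fail to commute with it, so the number of terms of
`A` does not enter. -/
theorem stateNorm_commutator_term_le
    (hA : ∀ a, A.term a ≠ PauliString.identity n → |A.coeff a| ≤ 1) {d : ℕ}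
    (hd : A.dualGraph.maxDegree ≤ d) (hM : M.PosSemidef) (htr : M.trace = 1) (a : Fin m) :
    stateNorm M (A.op * (A.term a).toMatrix - (A.term a).toMatrix * A.op) ≤ 2 * d := by
  have e : A.op * (A.term a).toMatrix - (A.term a).toMatrix * A.op =
      ∑ c ∈ A.dualGraph.neighborFinset a, (-((A.coeff c : ℂ) *
        (((A.term a).sign (A.term c) : ℂ) - 1))) • ((A.term c).toMatrix *
          (A.term a).toMatrix) := by
    rw [op, Finset.sum_mul, Finset.mul_sum, ← Finset.sum_sub_distrib]
    symm
    refine (Finset.sum_subset (Finset.subset_univ _) fun c _ hc => ?_).trans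
      (Finset.sum_congr rfl fun c _ => ?_)
    · have hs : (A.term a).sign (A.term c) = 1 := by
        by_cases hac : a = c
        · subst hac
          exact Finset.prod_eq_one fun i _ => by simp [Pauli.sign]
        · refine PauliString.sign_eq_one_of_disjoint fun h => hc ?_
          rw [SimpleGraph.mem_neighborFinset]
          exact ⟨hac, h⟩
      simp [hs]
    · rw [Matrix.smul_mul, Matrix.mul_smul, PauliString.toMatrix_mul_comm (A.term a) (A.term c),
        smul_smul, ← sub_smul]
      congr 1
      ring
  rw [e]
  calc _ ≤ ∑ c ∈ A.dualGraph.neighborFinset a, (2 : ℝ) := by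
        refine (stateNorm_sum_le hM _ _).trans (Finset.sum_le_sum fun c hc => ?_)
        rw [stateNorm_smul hM, PauliString.stateNorm_toMatrix_mul,
          PauliString.stateNorm_toMatrix _ htr, mul_one, norm_neg]
        rw [SimpleGraph.mem_neighborFinset] at hc
        refine norm_coeff_mul_sign_sub_one_le (S := (A.term a).support) hA _ (mem_meeting.2 ?_)
        rw [Finset.inter_comm]
        exact hc.2
    _ = A.dualGraph.degree a * 2 := by
        rw [Finset.sum_const, nsmul_eq_mul, SimpleGraph.card_neighborFinset_eq_degree]
    _ ≤ d * 2 := by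
        gcongr
        exact (A.dualGraph.degree_le_maxDegree a).trans hd
    _ = _ := mul_comm _ _

theorem stateNorm_conj_op_mul_conj_op_sub_op_le
    (hA : ∀ a, A.term a ≠ PauliString.identity n → |A.coeff a| ≤ 1) {d : ℕ}
    (hd : A.dualGraph.maxDegree ≤ d) (hU : U ∈ PauliString.supportedIn S)
    (hN : (A.meeting S).card ≤ N) (hM : M.PosSemidef) (htr : M.trace = 1)
    (hsmall : stateNorm M A.op ≤ 1 / 4) :
    stateNorm M (U.toMatrix * A.op * U.toMatrix * (U.toMatrix * A.op * U.toMatrix - A.op)) ≤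
      N + 4 * N * d + 4 * N ^ 2 := by
  set D := U.toMatrix * A.op * U.toMatrix - A.op with hD
  -- Left factors `D` cost at most 2N each. In `A.op * D` the unbounded factor is on the left, so it
  -- is exchanged for `D * A.op`, where `A.op` is small, plus a commutator.
  have e : U.toMatrix * A.op * U.toMatrix * D = D * A.op + (A.op * D - D * A.op) + D * D := by
    have : U.toMatrix * A.op * U.toMatrix = A.op + D := by rw [hD]; abel
    rw [this]
    noncomm_ring
  have hone : stateNorm M (1 : Matrix (Fin n → Fin 2) (Fin n → Fin 2) ℂ) = 1 := by
    simp [stateNorm, htr]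
  have h1 := stateNorm_conj_op_sub_op_mul_le hA hU hN hM A.op
  have h2 := stateNorm_conj_op_sub_op_mul_le hA hU hN hM 1
  have h3 := stateNorm_conj_op_sub_op_mul_le hA hU hN hM D
  rw [hone, mul_one, mul_one, ← hD] at h2
  rw [← hD] at h1 h3
  have h4 : stateNorm M (A.op * D - D * A.op) ≤ 4 * N * d := by
    have e4 : A.op * D - D * A.op = ∑ a ∈ A.meeting S,
        ((A.coeff a : ℂ) * ((U.sign (A.term a) : ℂ) - 1)) •
          (A.op * (A.term a).toMatrix - (A.term a).toMatrix * A.op) := by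
      rw [hD, conj_op_sub_op_eq_sum_meeting A hU, Finset.mul_sum, Finset.sum_mul,
        ← Finset.sum_sub_distrib]
      refine Finset.sum_congr rfl fun a _ => ?_
      rw [Matrix.mul_smul, Matrix.smul_mul, smul_sub]
    rw [e4]
    calc _ ≤ ∑ a ∈ A.meeting S, (2 * (2 * d) : ℝ) := by
          refine (stateNorm_sum_le hM _ _).trans (Finset.sum_le_sum fun a ha => ?_)
          rw [stateNorm_smul hM]
          exact mul_le_mul (norm_coeff_mul_sign_sub_one_le hA U ha)
            (stateNorm_commutator_term_le hA hd hM htr a) (stateNorm_nonneg _ _) zero_le_two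
      _ = (A.meeting S).card * (2 * (2 * d)) := by rw [Finset.sum_const, nsmul_eq_mul]
      _ ≤ N * (2 * (2 * d)) := by gcongr
      _ = _ := by ring
  rw [e]
  have h5 := stateNorm_add_le hM (D * A.op + (A.op * D - D * A.op)) (D * D)
  have h6 := stateNorm_add_le hM (D * A.op) (A.op * D - D * A.op)
  have hN0 : (0 : ℝ) ≤ N := Nat.cast_nonneg N
  have h7 : 2 * (N : ℝ) * stateNorm M A.op ≤ 2 * N * (1 / 4) := by gcongr
  have h8 : 2 * (N : ℝ) * stateNorm M D ≤ 2 * N * (2 * N) := by gcongr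
  nlinarith

end Displacement

/-- The energy cost of conjugating with a Pauli product on `S`. -/
theorem norm_trace_conj_op_sub_op_mul_le {H : PauliSum n m} (hH : H.IsHamiltonian)
    {S : Finset (Fin n)} {U : PauliString n} (hU : U ∈ PauliString.supportedIn S)
    {M : Matrix (Fin n → Fin 2) (Fin n → Fin 2) ℂ} (hM : M.PosSemidef) {N : ℕ}
    (hN : (H.meeting S).card ≤ N) :
    ‖((U.toMatrix * H.op * U.toMatrix - H.op) * M).trace‖ ≤ 2 * N * M.trace.re := by
  have hM0 : 0 ≤ M.trace.re := (Complex.nonneg_iff.1 hM.trace_nonneg).1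
  rw [conj_op_sub_op_eq_sum_meeting H hU, Finset.sum_mul, trace_sum]
  calc _ ≤ ∑ a ∈ H.meeting S, 2 * M.trace.re := by
        refine (norm_sum_le _ _).trans (Finset.sum_le_sum fun a ha => ?_)
        rw [smul_mul, trace_smul, norm_smul]
        exact mul_le_mul (norm_coeff_mul_sign_sub_one_le (fun a _ => hH.abs_coeff_le_one a) U ha)
          (PauliString.norm_trace_toMatrix_mul_le _ hM) (norm_nonneg _) zero_le_two
    _ = (H.meeting S).card * (2 * M.trace.re) := by rw [Finset.sum_const, nsmul_eq_mul]
    _ ≤ N * (2 * M.trace.re) := by gcongr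
    _ = _ := by ring

theorem isHermitian_neg_smul_op (H : PauliSum n m) (β : ℝ) :
    (-(β : ℂ) • H.op).IsHermitian := by
  rw [IsHermitian, conjTranspose_smul, H.isHermitian_op.eq]
  simp

theorem re_trace_exp_pos (H : PauliSum n m) (β : ℝ) :
    0 < (NormedSpace.exp (-(β : ℂ) • H.op)).trace.re :=
  (Complex.pos_iff.1 (H.isHermitian_neg_smul_op β).posDef_exp.trace_pos).1

theorem trace_exp_eq_ofReal (H : PauliSum n m) (β : ℝ) :
    (NormedSpace.exp (-(β : ℂ) • H.op)).trace =
      ((NormedSpace.exp (-(β : ℂ) • H.op)).trace.re : ℂ) := by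
  have h := (Complex.pos_iff.1 (H.isHermitian_neg_smul_op β).posDef_exp.trace_pos).2
  exact Complex.ext rfl h.symm

theorem gibbs_eq (H : PauliSum n m) (β : ℝ) :
    H.gibbs β = (((NormedSpace.exp (-(β : ℂ) • H.op)).trace.re⁻¹ : ℝ) : ℂ) •
      NormedSpace.exp (-(β : ℂ) • H.op) := by
  rw [gibbs, Complex.ofReal_inv, ← trace_exp_eq_ofReal]

theorem posSemidef_gibbs (H : PauliSum n m) (β : ℝ) : (H.gibbs β).PosSemidef := by
  rw [gibbs_eq]
  refine (H.isHermitian_neg_smul_op β).posDef_exp.posSemidef.smul ?_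
  exact Complex.zero_le_real.2 (inv_nonneg.2 (H.re_trace_exp_pos β).le)

theorem trace_gibbs (H : PauliSum n m) (β : ℝ) : (H.gibbs β).trace = 1 := by
  rw [gibbs, trace_smul, smul_eq_mul, inv_mul_cancel₀]
  intro h
  have := H.re_trace_exp_pos β
  rw [h] at this
  exact lt_irrefl _ this

/-- Conjugating a Gibbs state by a Pauli product on few qubits changes the probability of an event
by at most a factor that is exponential in the inverse temperature, in the logarithmic scale. -/
theorem exp_le_trace_spectralMap_mul_gibbs {H : PauliSum n m} (hH : H.IsHamiltonian)
    {S : Finset (Fin n)} {U : PauliString n} (hU : U ∈ PauliString.supportedIn S) {N : ℕ}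
    (hN : (H.meeting S).card ≤ N) {β : ℝ} (hβ : 0 < β)
    {A : Matrix (Fin n → Fin 2) (Fin n → Fin 2) ℂ} (hA : A.IsHermitian) {f : ℝ → ℝ}
    (hf : ∀ x, f x = 0 ∨ f x = 1) {p : ℝ} (hp : 0 < p)
    (hpU : p ≤ (hA.spectralMap f * (U.toMatrix * H.gibbs β * U.toMatrix)).trace.re) :
    Real.exp (-((β * (2 * N) + Real.log 2) / p)) ≤ (hA.spectralMap f * H.gibbs β).trace.re := by
  set X := -(β : ℂ) • H.op with hX
  set Z := (NormedSpace.exp X).trace.re with hZ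
  have hZ0 : 0 < Z := H.re_trace_exp_pos β
  set K := U.toMatrix * X * U.toMatrix with hK
  set Y := X - K with hY
  have hXh : X.IsHermitian := H.isHermitian_neg_smul_op β
  have hKh : K.IsHermitian := by
    rw [hK, IsHermitian, conjTranspose_mul, conjTranspose_mul, U.isHermitian_toMatrix.eq, hXh.eq,
      mul_assoc]
  have hKY : K + Y = X := by rw [hY]; abel
  have hexpK : NormedSpace.exp K = U.toMatrix * NormedSpace.exp X * U.toMatrix := by
    have := Matrix.exp_conj U.toMatrix X U.isUnit_toMatrix
    rwa [U.inv_toMatrix] at this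
  have hZK : (NormedSpace.exp K).trace.re = Z := by
    rw [hexpK, trace_mul_comm, ← mul_assoc, U.toMatrix_mul_self, one_mul]
  have hgibbs : H.gibbs β = ((Z⁻¹ : ℝ) : ℂ) • NormedSpace.exp X := H.gibbs_eq β
  have hYe : Y = (β : ℂ) • (U.toMatrix * H.op * U.toMatrix - H.op) := by
    rw [hY, hK, hX, Matrix.mul_smul, Matrix.smul_mul, smul_sub, neg_smul, neg_smul]
    abel
  -- `K` gives the conjugated state, where the event is likely, and `K + Y = X` gives the Gibbs
  -- state itself.
  have h := exp_mul_trace_exp_le_of_event (v := β * (2 * N)) (p := p) hA hKh (hXh.sub hKh) hf hp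
    (by positivity) (by rw [← hY, hKY, hZK]) ?_ ?_
  · rw [← hY, hKY] at h
    rw [hgibbs, Matrix.mul_smul, trace_smul, smul_eq_mul, Complex.re_ofReal_mul,
      ← div_eq_inv_mul, le_div_iff₀ hZ0]
    exact h
  · rw [hgibbs, Matrix.mul_smul, Matrix.smul_mul, Matrix.mul_smul, trace_smul, smul_eq_mul,
      Complex.re_ofReal_mul, ← div_eq_inv_mul, le_div_iff₀ hZ0, ← hexpK] at hpU
    rwa [hZK]
  · have h1 := norm_trace_conj_op_sub_op_mul_le hH hU hKh.posDef_exp.posSemidef hN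
    have h2 := neg_le_of_abs_le ((Complex.abs_re_le_norm _).trans h1)
    rw [← hY, hYe, smul_mul, trace_smul, smul_eq_mul, Complex.re_ofReal_mul]
    nlinarith

theorem trace_op_sq_mul {r : ℕ} (A : PauliSum n r)
    {M : Matrix (Fin n → Fin 2) (Fin n → Fin 2) ℂ} (hM : M.PosSemidef) :
    (A.op ^ 2 * M).trace = ((stateNorm M A.op ^ 2 : ℝ) : ℂ) := by
  have e : (A.op ^ 2 * M).trace = (A.op * M * A.opᴴ).trace := by
    rw [A.isHermitian_op.eq, pow_two, mul_assoc, trace_mul_comm]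
  have h := Complex.nonneg_iff.1 (hM.mul_mul_conjTranspose_same A.op).trace_nonneg
  rw [e, sq_stateNorm hM]
  exact Complex.ext rfl h.2.symm

/-- The lower bound on `tr(A²ρ)` for an operator `A` whose largest coefficient on a nontrivial Pauli
product is `1`. -/
theorem exp_le_sq_stateNorm_gibbs {d k' d' r : ℕ} {H : PauliSum n m} (hH : H.IsHamiltonian)
    (hHd : H.dualGraph.maxDegree ≤ d) {A : PauliSum n r} (hAk : A.IsLocal k')
    (hAd : A.dualGraph.maxDegree ≤ d')
    (hA : ∀ a, A.term a ≠ PauliString.identity n → |A.coeff a| ≤ 1) {b : Fin r}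
    (hb : A.term b ≠ PauliString.identity n) (hb1 : |A.coeff b| = 1) {β : ℝ} (hβ : 0 < β)
    {s N Nh : ℕ} (hs : s = (d' + 1) * k') (hN : N = s * (d' + 1)) (hNh : Nh = s * (d + 1))
    {G : ℝ} (hG : G = 1 + N + 4 * N * d' + 4 * N ^ 2) :
    Real.exp (-(Real.log 16 + 4 * G ^ 2 * Real.log 2) - 4 * G ^ 2 * (2 * Nh) * β) ≤
      stateNorm (H.gibbs β) A.op ^ 2 := by
  have hM := H.posSemidef_gibbs β
  have htr := H.trace_gibbs β
  have hG0 : 0 < G := by rw [hG]; positivity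
  have hexp : Real.exp (-(Real.log 16 + 4 * G ^ 2 * Real.log 2) - 4 * G ^ 2 * (2 * Nh) * β) =
      1 / 16 * Real.exp (-((β * (2 * Nh) + Real.log 2) / (1 / (4 * G ^ 2)))) := by
    have : (1 / 16 : ℝ) = Real.exp (-Real.log 16) := by
      rw [Real.exp_neg, Real.exp_log (by norm_num)]; norm_num
    rw [this, ← Real.exp_add]
    congr 1
    field_simp
    ring
  rw [hexp]
  by_cases hsmall : stateNorm (H.gibbs β) A.op ≤ 1 / 4
  · set S := A.neighborhood b with hS
    have hScard : S.card ≤ s := hs ▸ A.card_neighborhood_le hAk hAd b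
    obtain ⟨U, hU, hlarge⟩ := A.exists_abs_coeff_le_stateNorm hb hM htr
    rw [hb1] at hlarge
    have hAN : (A.meeting S).card ≤ N :=
      hN ▸ (A.card_meeting_le hAd S).trans (Nat.mul_le_mul_right _ hScard)
    have hHN : (H.meeting S).card ≤ Nh :=
      hNh ▸ (H.card_meeting_le hHd S).trans (Nat.mul_le_mul_right _ hScard)
    have hcomm := stateNorm_conj_op_mul_conj_op_sub_op_le hA hAd hU hAN hM htr hsmall
    have hp := le_trace_indicator_conj A.isHermitian_op U.isHermitian_toMatrix
      U.toMatrix_mul_self hM htr hG0 hsmall hlarge (hcomm.trans (by rw [hG]; linarith))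
    have hq := exp_le_trace_spectralMap_mul_gibbs hH hU hHN hβ A.isHermitian_op
      (fun x => by split_ifs <;> simp) (by positivity) hp
    -- Chebyshev: the indicator of |x| ≥ 1/4 is at most 16x².
    have hcheb := A.isHermitian_op.re_trace_spectralMap_mul_le hM
      (f := fun x => if |x| < 1 / 4 then 0 else 1) (g := fun x => 16 * (x * x)) fun x => by
        split_ifs with h
        · have := mul_self_nonneg x
          linarith
        · have := mul_self_le_mul_self (by norm_num) (not_lt.1 h)
          rw [abs_mul_abs_self] at this
          linarith
    rw [← IsHermitian.spectralMap_smul, ← IsHermitian.spectralMap_mul, IsHermitian.spectralMap_id,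
      smul_mul, trace_smul, smul_eq_mul, Complex.re_ofReal_mul, ← pow_two,
      A.trace_op_sq_mul hM, Complex.ofReal_re] at hcheb
    linarith
  · have h1 : Real.exp (-((β * (2 * Nh) + Real.log 2) / (1 / (4 * G ^ 2)))) ≤ 1 := by
      rw [Real.exp_le_one_iff, neg_nonpos]
      have := Real.log_nonneg (one_le_two (α := ℝ))
      positivity
    have h2 := not_le.1 hsmall
    nlinarith

/-! ### Normalization and conclusion. -/

/-- A rescaled Pauli sum. -/
def rescale {r : ℕ} (A : PauliSum n r) (t : ℝ) : PauliSum n r where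
  term := A.term
  coeff a := t * A.coeff a
  term_injective := A.term_injective

theorem op_rescale {r : ℕ} (A : PauliSum n r) (t : ℝ) : (A.rescale t).op = (t : ℂ) • A.op := by
  rw [op, op, Finset.smul_sum]
  refine Finset.sum_congr rfl fun a _ => ?_
  rw [smul_smul, rescale, Complex.ofReal_mul]

end PauliSum

/-- No small local marginals. The inequality is between complex numbers, in the order of `ℂ`: it
says that the trace on the right is real and at least the real number on the left. -/
theorem mainTheorem8 (k d k' d' : ℕ) :
    ∃ c c' : ℝ,
      ∀ (n m : ℕ) (H : PauliSum n m),
        H.IsHamiltonian → H.IsLocal k → H.dualGraph.maxDegree ≤ d →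
      ∀ (r : ℕ) (A : PauliSum n r),
        A.IsLocal k' → A.dualGraph.maxDegree ≤ d' →
      ∀ β : ℝ, 0 < β →
      ∀ b : Fin r, A.term b ≠ PauliString.identity n →
        ((Real.exp (-c - c' * β) * A.coeff b ^ 2 : ℝ) : ℂ) ≤
          (A.op ^ 2 * H.gibbs β).trace := by
  obtain ⟨s, hs⟩ : ∃ s, s = (d' + 1) * k' := ⟨_, rfl⟩
  obtain ⟨N, hN⟩ : ∃ N, N = s * (d' + 1) := ⟨_, rfl⟩
  obtain ⟨Nh, hNh⟩ : ∃ Nh, Nh = s * (d + 1) := ⟨_, rfl⟩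
  -- The summand 1 only keeps `G` positive when `N = 0`; the rest bounds ‖BD‖.
  obtain ⟨G, hG⟩ : ∃ G : ℝ, G = 1 + N + 4 * N * d' + 4 * N ^ 2 := ⟨_, rfl⟩
  refine ⟨Real.log 16 + 4 * G ^ 2 * Real.log 2, 4 * G ^ 2 * (2 * Nh), ?_⟩
  intro n m H hH _ hHd r A hAk hAd β hβ b hb
  have hM := H.posSemidef_gibbs β
  rw [A.trace_op_sq_mul hM, Complex.real_le_real]
  obtain ⟨b', hb', hmax⟩ := (Finset.univ.filter fun a => A.term a ≠
    PauliString.identity n).exists_max_image (fun a => |A.coeff a|) ⟨b, by simpa using hb⟩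
  simp only [Finset.mem_filter, Finset.mem_univ, true_and] at hb' hmax
  have hle : A.coeff b ^ 2 ≤ A.coeff b' ^ 2 := sq_le_sq.2 (hmax b hb)
  -- Both sides are quadratic in `A`, so dividing by the largest coefficient loses nothing; if that
  -- coefficient vanishes, the lower bound is 0.
  rcases (abs_nonneg (A.coeff b')).eq_or_lt with h0 | hpos
  · have hz : A.coeff b ^ 2 = 0 := by
      rw [abs_eq_zero.1 h0.symm] at hle
      exact le_antisymm (by simpa using hle) (sq_nonneg _)
    rw [hz, mul_zero]
    positivity
  · set t := |A.coeff b'|⁻¹ with ht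
    have ht0 : 0 < t := inv_pos.2 hpos
    have habs : ∀ a, |(A.rescale t).coeff a| = t * |A.coeff a| := fun a => by
      change |t * A.coeff a| = _
      rw [abs_mul, abs_of_pos ht0]
    have h := PauliSum.exp_le_sq_stateNorm_gibbs (A := A.rescale t) hH hHd hAk hAd
      (fun a ha => by
        rw [habs, ht, inv_mul_le_iff₀ hpos, mul_one]
        exact hmax a ha)
      hb' (by rw [habs, ht, inv_mul_cancel₀ hpos.ne']) hβ hs hN hNh hG
    rw [PauliSum.op_rescale, stateNorm_smul hM, Complex.norm_real, Real.norm_of_nonneg ht0.le,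
      mul_pow, ht, inv_pow, sq_abs, ← div_eq_inv_mul,
      le_div_iff₀ (by rw [← sq_abs]; positivity)] at h
    exact (mul_le_mul_of_nonneg_left hle (Real.exp_nonneg _)).trans h
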